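/- Let $G=(V,E)$ be a finite connected simple median graph: writing $I(u,v)=\{x: d(u,x)+d(x,v)=d(u,v)\}$, any three vertices $x,y,z$ have exactly one median $m(x,y,z)\in I(x,y)\cap I(y,z)\cap I(z,x)$. Fix a basepoint $v_0\in V$ and orient every edge $xy$ from $x$ to $y$ when $d(v_0,x)<d(v_0,y)$. Definitions. The $\Theta$-classes are the classes of edges under the reflexive and transitive closure of the relation "being opposite edges of a square". Two classes $E_i,E_j$ are orthogonal if some square has one pair of opposite edges in $E_i$ and the other pair in $E_j$. A set of classes is a POF if its distinct members are pairwise orthogonal (the empty set is a POF). A POF is outgoing from (resp. ingoing to) $u$ if each of its classes has an edge outgoing from (resp. going into) $u$. The classes of an induced hypercube $Q$ (single vertices are allowed, as $0$-dimensional hypercubes) are the classes of its edges; its basis (resp. anti-basis) is the vertex of $Q$ all of whose incident edges in $Q$ are outgoing from it (resp. going into it). For $u\in I(v_0,v)$, the ladder set $L_{u,v}$ is the set of classes $E_i$ such that $E_i$ has an edge at $u$ and $u,v$ lie in different components of $G\setminus E_i$. For $u\in I(v_0,v)$ with $u\neq v$, let $u^+$ be the anti-basis of the hypercube with basis $u$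 and set of classes $L_{u,v}$; the set of milestones is defined recursively by $\Pi(u,v)=\{u,v\}$ if $u^+=v$, and $\Pi(u,v)=\{u\}\cup\Pi(u^+,v)$ otherwise. The penultimate milestone $\overline{\pi}(u,v)$ is the element of $\Pi(u,v)\setminus\{v\}$ closest to $v$. Labels. For a POF $L$ outgoing from $u$, $\varphi(u,L)$ is the maximum of $d(u,v)$ over the vertices $v$ with $u\in I(v_0,v)$ and $L_{u,v}=L$. For a POF $X$ ingoing to $u$, let $u^-$ be the basis of the hypercube with anti-basis $u$ and set of classes $X$; $\psi(u,X)$ is the maximum of $d(u,v)$ over the vertices $v$ such that $m=m(u,v,v_0)\neq u$ and $\overline{\pi}(m,u)=u^-$. For $X=\emptyset$ there is no such $v$, and we put $\psi(u,\emptyset)=0$. Theorem. For every vertex $u\in V$, the maxima defining $\varphi(u,L)$ (for each POF $L$ outgoing from $u$) and $\psi(u,X)$ (for each nonempty POF $X$ ingoing to $u$) are over nonempty sets, hence attained, and the eccentricity $\mathrm{ecc}(u)=\max_{v\in V}d(u,v)$ satisfies $$\mathrm{ecc}(u)=\max\Bigl\{\max_{L\text{ POF outgoing from }u}\varphi(u,L),\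 \max_{X\text{ POF ingoing to }u}\psi(u,X)\Bigr\}.$$ -/

import Mathlib

namespace MedianGraph

variable {V : Type*}

/-- The interval `I(u,v)`: the vertices lying on shortest `(u,v)`-paths. -/
def interval (G : SimpleGraph V) (u v : V) : Set V :=
  {x | G.dist u x + G.dist x v = G.dist u v}

/-- `m` is a median of `x`, `y`, `z`. -/
def IsMedian (G : SimpleGraph V) (x y z m : V) : Prop :=
  m ∈ interval G x y ∩ interval G y z ∩ interval G z x

/-- A median graph: connected, and every triple of vertices has exactly one median.
(For a triple with a repetition the unique-median condition holds in every connected graph, so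
quantifying over all triples is the same as quantifying over triples of distinct vertices.) -/
structure IsMedianGraph (G : SimpleGraph V) : Prop where
  connected : G.Connected
  existsUnique_median : ∀ x y z : V, ∃! m, IsMedian G x y z m

/-- `a b c d` is a square (a 4-cycle, in this cyclic order). -/
structure IsSquare (G : SimpleGraph V) (a b c d : V) : Prop where
  adj_ab : G.Adj a b
  adj_bc : G.Adj b c
  adj_cd : G.Adj c d
  adj_da : G.Adj d a
  ne_ac : a ≠ c
  ne_bd : b ≠ d

/-- The relation `Θ₀`: two edges `uv` and `xy` are opposite edges of a square `u v y x`. -/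
def Theta0 (G : SimpleGraph V) (e f : G.edgeSet) : Prop :=
  ∃ u v x y : V, (e : Sym2 V) = s(u, v) ∧ (f : Sym2 V) = s(x, y) ∧ IsSquare G u v y x

theorem Theta0.symm {G : SimpleGraph V} {e f : G.edgeSet} (h : Theta0 G e f) :
    Theta0 G f e := by
  obtain ⟨u, v, x, y, he, hf, hs⟩ := h
  exact ⟨x, y, u, v, hf, he,
    ⟨hs.adj_cd.symm, hs.adj_bc.symm, hs.adj_ab.symm, hs.adj_da.symm, hs.ne_bd.symm, hs.ne_ac.symm⟩⟩

/-- The relation `Θ`: the reflexive and transitive closure of `Θ₀`. -/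
def thetaSetoid (G : SimpleGraph V) : Setoid G.edgeSet where
  r := Relation.ReflTransGen (Theta0 G)
  iseqv :=
    { refl := fun _ => Relation.ReflTransGen.refl
      symm := fun h => by
        induction h with
        | refl => exact Relation.ReflTransGen.refl
        | tail _ hbc ih => exact Relation.ReflTransGen.head hbc.symm ih
      trans := fun h₁ h₂ => h₁.trans h₂ }

/-- The type of `Θ`-classes of `G`. -/
def ThetaClass (G : SimpleGraph V) : Type _ := Quotient (thetaSetoid G)

/-- The set of edges belonging to a `Θ`-class. -/
def ThetaClass.edges {G : SimpleGraph V} (E : ThetaClass G) : Set (Sym2 V) :=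
  {e | ∃ h : e ∈ G.edgeSet, (Quotient.mk (thetaSetoid G) ⟨e, h⟩ : ThetaClass G) = E}

/-- Orthogonal classes: some square has one pair of opposite edges in `E` and the other pair
in `F`. -/
def Orthogonal {G : SimpleGraph V} (E F : ThetaClass G) : Prop :=
  ∃ u v y x : V, IsSquare G u v y x ∧ s(u, v) ∈ E.edges ∧ s(x, y) ∈ E.edges ∧
    s(u, x) ∈ F.edges ∧ s(v, y) ∈ F.edges

/-- Pairwise orthogonal families (POFs) of `Θ`-classes. -/
def IsPOF {G : SimpleGraph V} (X : Set (ThetaClass G)) : Prop :=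
  X.Pairwise Orthogonal

/-- With respect to the basepoint `v₀`, every class of `X` has an edge outgoing from `u`. -/
def IsOutgoing {G : SimpleGraph V} (v₀ u : V) (X : Set (ThetaClass G)) : Prop :=
  ∀ E ∈ X, ∃ w, s(u, w) ∈ E.edges ∧ G.dist v₀ u < G.dist v₀ w

/-- With respect to the basepoint `v₀`, every class of `X` has an edge going into `u`. -/
def IsIngoing {G : SimpleGraph V} (v₀ u : V) (X : Set (ThetaClass G)) : Prop :=
  ∀ E ∈ X, ∃ w, s(u, w) ∈ E.edges ∧ G.dist v₀ w < G.dist v₀ u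

/-- The signature `σ_{u,v}`: the classes `E` such that `u` and `v` are separated in `G ∖ E`. -/
def signature (G : SimpleGraph V) (u v : V) : Set (ThetaClass G) :=
  {E | ¬ (G.deleteEdges E.edges).Reachable u v}

/-- The ladder set `L_{u,v}`: the classes of `σ_{u,v}` having an edge at `u`.
(Used for `u ∈ I(v₀,v)`.) -/
def ladderSet (G : SimpleGraph V) (u v : V) : Set (ThetaClass G) :=
  {E | E ∈ signature G u v ∧ ∃ w, s(u, w) ∈ E.edges}

/-- The `k`-dimensional hypercube: subsets of a `k`-element set, adjacent when they differ by
exactly one element. -/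
def hypercube (k : ℕ) : SimpleGraph (Finset (Fin k)) where
  Adj A B := (symmDiff A B).card = 1
  symm := ⟨fun A B h => by rwa [symmDiff_comm]⟩
  loopless := ⟨fun A h => by simp at h⟩

/-- `Q` is the vertex set of an induced hypercube of `G`. -/
def IsHypercube (G : SimpleGraph V) (Q : Set V) : Prop :=
  ∃ k : ℕ, Nonempty (hypercube k ≃g G.induce Q)

/-- The `Θ`-classes represented in the edges of the subgraph induced by `Q`. -/
def setSignature (G : SimpleGraph V) (Q : Set V) : Set (ThetaClass G) :=
  {E | ∃ x ∈ Q, ∃ y ∈ Q, s(x, y) ∈ E.edges}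

/-- `b` is the basis of `Q`: all edges of `Q` at `b` are outgoing from `b`. -/
def IsBasis (G : SimpleGraph V) (v₀ : V) (Q : Set V) (b : V) : Prop :=
  b ∈ Q ∧ ∀ w ∈ Q, G.Adj b w → G.dist v₀ b < G.dist v₀ w

/-- `a` is the anti-basis of `Q`: all edges of `Q` at `a` are going into `a`. -/
def IsAntiBasis (G : SimpleGraph V) (v₀ : V) (Q : Set V) (a : V) : Prop :=
  a ∈ Q ∧ ∀ w ∈ Q, G.Adj a w → G.dist v₀ w < G.dist v₀ a

/-- There is an induced hypercube with basis `b`, anti-basis `a` and set of classes `X`. -/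
def HypercubeBetween (G : SimpleGraph V) (v₀ : V) (X : Set (ThetaClass G)) (b a : V) : Prop :=
  ∃ Q : Set V, IsHypercube G Q ∧ setSignature G Q = X ∧ IsBasis G v₀ Q b ∧ IsAntiBasis G v₀ Q a

/-- `IsMilestone G v₀ v u p` says that `p ∈ Π(u,v)`. For `u ∈ I(v₀,v)`, let `u⁺` be the anti-basis
of the hypercube with basis `u` and signature `L_{u,v}`; then `Π(u,v) = {u,v}` if `u⁺ = v`, and
`Π(u,v) = {u} ∪ Π(u⁺,v)` otherwise. -/
inductive IsMilestone (G : SimpleGraph V) (v₀ v : V) : V → V → Prop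
  | first {u : V} (hu : u ∈ interval G v₀ v) : IsMilestone G v₀ v u u
  | last {u : V} (hu : u ∈ interval G v₀ v)
      (hcube : HypercubeBetween G v₀ (ladderSet G u v) u v) : IsMilestone G v₀ v u v
  | step {u u' p : V} (hu : u ∈ interval G v₀ v)
      (hcube : HypercubeBetween G v₀ (ladderSet G u v) u u') (hne : u' ≠ v)
      (hp : IsMilestone G v₀ v u' p) : IsMilestone G v₀ v u p

/-- The set `Π(u,v)` of milestones. -/
def milestones (G : SimpleGraph V) (v₀ u v : V) : Set V :=
  {p | IsMilestone G v₀ v u p}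

/-- `p` is the penultimate milestone of `(u,v)`: the milestone different from `v` that is
closest to `v`. -/
def IsPenultimate (G : SimpleGraph V) (v₀ u v p : V) : Prop :=
  p ∈ milestones G v₀ u v ∧ p ≠ v ∧
    ∀ q ∈ milestones G v₀ u v, q ≠ v → G.dist p v ≤ G.dist q v

/-- The distances `d(u,v)` over the vertices `v` with `u ∈ I(v₀,v)` and `L_{u,v} = L`. -/
def phiDistances (G : SimpleGraph V) (v₀ u : V) (L : Set (ThetaClass G)) : Set ℕ :=
  {d | ∃ v, u ∈ interval G v₀ v ∧ ladderSet G u v = L ∧ d = G.dist u v}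

/-- The label `φ(u,L)`. -/
noncomputable def phi (G : SimpleGraph V) (v₀ u : V) (L : Set (ThetaClass G)) : ℕ :=
  sSup (phiDistances G v₀ u L)

/-- The distances `d(u,v)` over the vertices `v` such that `m = m(u,v,v₀)` is different from `u`,
and the penultimate milestone of `(m,u)` is the basis `u⁻` of the hypercube with anti-basis `u`
and set of classes `X`. -/
def psiDistances (G : SimpleGraph V) (v₀ u : V) (X : Set (ThetaClass G)) : Set ℕ :=
  {d | ∃ v m u' : V, IsMedian G u v v₀ m ∧ m ≠ u ∧ HypercubeBetween G v₀ X u' u ∧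
    IsPenultimate G v₀ m u u' ∧ d = G.dist u v}

/-- The label `ψ(u,X)`. For `X = ∅` there is no admissible `v`, and the value is `0`. -/
noncomputable def psi (G : SimpleGraph V) (v₀ u : V) (X : Set (ThetaClass G)) : ℕ :=
  sSup (psiDistances G v₀ u X)

/-- The POFs outgoing from `u`. -/
def outgoingPOFs (G : SimpleGraph V) (v₀ u : V) : Set (Set (ThetaClass G)) :=
  {L | IsPOF L ∧ IsOutgoing v₀ u L}

/-- The POFs ingoing to `u`. -/
def ingoingPOFs (G : SimpleGraph V) (v₀ u : V) : Set (Set (ThetaClass G)) :=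
  {X | IsPOF X ∧ IsIngoing v₀ u X}

end MedianGraph

/-! Every Θ-class cuts `G` into two complementary half-spaces, so a vertex is encoded, relative to
any base vertex, by the set of classes separating it from that base. In this encoding distance is
the cardinality of a symmetric difference (`ncard_signature`), intervals are inclusions
(`mem_interval_iff`), medians are majority votes (`exists_majority`), and an edge points away from
`v₀` exactly when its class does not yet separate its tail from `v₀` (`dist_lt_iff`). The majority
vote shows that all subsets of a POF present at a vertex can be flipped there
(`exists_signature_eq`), which produces the hypercubes behind ladder sets and milestones.

For the eccentricity, take any `v` and let `m` be the median of `u`, `v`, `v₀`. If `m = u`, then `u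
∈ I(v₀,v)`, the ladder set of `(u,v)` is an outgoing POF, and `v` is counted by its label `φ`. If `m
≠ u`, the last hypercube on the milestone chain from `m` to `u` gives an ingoing POF whose label `ψ`
counts `v`. Conversely, every label is a supremum of distances from `u`. -/

namespace MedianGraph

variable {V : Type*} {G : SimpleGraph V}

/-! ### Metric consequences of unique medians: squares and half-spaces. -/

/-- The half-space of the vertices closer to `a` than to `b`. -/
def halfspace (G : SimpleGraph V) (a b : V) : Set V :=
  {x | G.dist x a < G.dist x b}

theorem exists_adj_dist_eq (hc : G.Connected) {u v : V} {n : ℕ} (h : G.dist u v = n + 1) :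
    ∃ w, G.Adj u w ∧ G.dist w v = n := by
  obtain ⟨p, hp⟩ := (hc u v).exists_walk_length_eq_dist
  cases p with
  | nil => simp at h
  | cons hadj q =>
    rename_i w
    refine ⟨w, hadj, ?_⟩
    have h1 := SimpleGraph.dist_le q
    have h2 := hc.dist_triangle (u := u) (v := w) (w := v)
    have h3 := SimpleGraph.dist_eq_one_iff_adj.mpr hadj
    simp only [SimpleGraph.Walk.length_cons] at hp
    omega

/-- The median of `x`, `a`, `b` lies in `I(a,b) = {a, b}`, so one end of the edge is on a geodesic
from `x` to the other. -/
theorem IsMedianGraph.dist_adj (hG : IsMedianGraph G) {a b : V} (hab : G.Adj a b) (x : V) :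
    G.dist x b = G.dist x a + 1 ∨ G.dist x a = G.dist x b + 1 := by
  obtain ⟨m, ⟨⟨h1, h2⟩, h3⟩, -⟩ := hG.existsUnique_median x a b
  simp only [interval, Set.mem_ofPred_eq] at h1 h2 h3
  have hd := SimpleGraph.dist_eq_one_iff_adj.mpr hab
  have e1 := G.dist_comm (u := m) (v := a)
  have e2 := G.dist_comm (u := m) (v := b)
  have e3 := G.dist_comm (u := m) (v := x)
  have e4 := G.dist_comm (u := b) (v := x)
  omega

theorem IsMedianGraph.eq_of_isMedian (hG : IsMedianGraph G) {x y z m m' : V}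
    (h : IsMedian G x y z m) (h' : IsMedian G x y z m') : m = m' :=
  (hG.existsUnique_median x y z).unique h h'

theorem IsMedianGraph.dist_eq_two (hG : IsMedianGraph G) {y w z : V} (hy : G.Adj y w)
    (hz : G.Adj w z) (hne : y ≠ z) : G.dist y z = 2 := by
  have h0 := hG.connected.pos_dist_of_ne hne
  have h1 := SimpleGraph.dist_eq_one_iff_adj.mpr hy
  have := hG.dist_adj hz y
  omega

/-- The quadrangle condition. -/
theorem IsMedianGraph.quadrangle (hG : IsMedianGraph G) {x w y z : V} {n : ℕ} (hy : G.Adj y w)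
    (hz : G.Adj w z) (hne : y ≠ z) (hxy : G.dist x y = n) (hxz : G.dist x z = n)
    (hxw : G.dist x w = n + 1) :
    ∃ t, G.Adj y t ∧ G.Adj t z ∧ G.dist x t + 1 = n := by
  obtain ⟨t, ⟨⟨h1, h2⟩, h3⟩, -⟩ := hG.existsUnique_median x y z
  simp only [interval, Set.mem_ofPred_eq] at h1 h2 h3
  have hd := hG.dist_eq_two hy hz hne
  have e1 := G.dist_comm (u := t) (v := y)
  have e3 := G.dist_comm (u := t) (v := z)
  have e2 := G.dist_comm (u := t) (v := x)
  have e4 := G.dist_comm (u := z) (v := x)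
  exact ⟨t, SimpleGraph.dist_eq_one_iff_adj.mp (by omega),
    SimpleGraph.dist_eq_one_iff_adj.mp (by omega), by omega⟩

/-- A median graph contains no `K_{2,3}`. -/
theorem IsMedianGraph.eq_of_common_neighbors (hG : IsMedianGraph G) {a b x y z : V}
    (hax : G.Adj a x) (hay : G.Adj a y) (haz : G.Adj a z) (hbx : G.Adj b x) (hby : G.Adj b y)
    (hbz : G.Adj b z) (hxy : x ≠ y) (hyz : y ≠ z) (hzx : z ≠ x) : a = b := by
  have key : ∀ c, G.Adj c x → G.Adj c y → G.Adj c z → IsMedian G x y z c := by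
    intro c hx hy hz
    refine ⟨⟨?_, ?_⟩, ?_⟩ <;> simp only [interval, Set.mem_ofPred_eq]
    · rw [hG.dist_eq_two hx.symm hy hxy, SimpleGraph.dist_eq_one_iff_adj.mpr hx.symm,
        SimpleGraph.dist_eq_one_iff_adj.mpr hy]
    · rw [hG.dist_eq_two hy.symm hz hyz, SimpleGraph.dist_eq_one_iff_adj.mpr hy.symm,
        SimpleGraph.dist_eq_one_iff_adj.mpr hz]
    · rw [hG.dist_eq_two hz.symm hx hzx, SimpleGraph.dist_eq_one_iff_adj.mpr hz.symm,
        SimpleGraph.dist_eq_one_iff_adj.mpr hx]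
  exact hG.eq_of_isMedian (key a hax hay haz) (key b hbx hby hbz)

/-- If `p` violated the inclusion, `u` and `y` would be equally far from `p`, with `v` one step
farther. The quadrangle condition then gives a common neighbour `t` of `u` and `y` closer to `p`,
and `v`, `x`, `t` form a `K_{2,3}` with `u`, `y`. -/
theorem IsMedianGraph.halfspace_subset_of_isSquare (hG : IsMedianGraph G) {u v y x : V}
    (h : IsSquare G u v y x) : halfspace G u v ⊆ halfspace G x y := by
  intro p hp
  simp only [halfspace, Set.mem_ofPred_eq] at hp ⊢
  have h1 := hG.dist_adj h.adj_ab p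
  have h2 := hG.dist_adj h.adj_bc p
  have h3 := hG.dist_adj h.adj_cd p
  have h4 := hG.dist_adj h.adj_da p
  by_contra hcon
  obtain ⟨t, hut, hty, ht⟩ := hG.quadrangle (x := p) (n := G.dist p u) h.adj_ab h.adj_bc h.ne_ac
    rfl (by omega) (by omega)
  refine h.ne_ac (hG.eq_of_common_neighbors h.adj_ab h.adj_da.symm hut h.adj_bc.symm h.adj_cd
    hty.symm h.ne_bd ?_ ?_)
  · rintro rfl; omega
  · rintro rfl; omega

theorem IsSquare.reflect {a b c d : V} (h : IsSquare G a b c d) : IsSquare G d c b a :=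
  ⟨h.adj_cd.symm, h.adj_bc.symm, h.adj_ab.symm, h.adj_da.symm, h.ne_bd.symm, h.ne_ac.symm⟩

theorem IsSquare.swap {a b c d : V} (h : IsSquare G a b c d) : IsSquare G b a d c :=
  ⟨h.adj_ab.symm, h.adj_da.symm, h.adj_cd.symm, h.adj_bc.symm, h.ne_bd, h.ne_ac⟩

theorem IsMedianGraph.halfspace_eq_of_isSquare (hG : IsMedianGraph G) {u v y x : V}
    (h : IsSquare G u v y x) : halfspace G u v = halfspace G x y :=
  (hG.halfspace_subset_of_isSquare h).antisymm (hG.halfspace_subset_of_isSquare h.reflect)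

theorem IsMedianGraph.mem_halfspace_swap (hG : IsMedianGraph G) {a b : V} (hab : G.Adj a b)
    (x : V) : x ∈ halfspace G b a ↔ x ∉ halfspace G a b := by
  have := hG.dist_adj hab x
  simp only [halfspace, Set.mem_ofPred_eq]
  omega

/-! ### Θ-classes as the cuts between complementary half-spaces. -/

/-- The vertices `u` and `v` lie on different sides of the edge `e`. -/
def Separates (G : SimpleGraph V) (e : Sym2 V) (u v : V) : Prop :=
  ∃ a b, e = s(a, b) ∧ u ∈ halfspace G a b ∧ v ∈ halfspace G b a

theorem separates_mk {a b u v : V} : Separates G s(a, b) u v ↔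
    (u ∈ halfspace G a b ∧ v ∈ halfspace G b a) ∨
      (u ∈ halfspace G b a ∧ v ∈ halfspace G a b) := by
  constructor
  · rintro ⟨c, d, h, h1, h2⟩
    rcases Sym2.eq_iff.mp h with ⟨rfl, rfl⟩ | ⟨rfl, rfl⟩
    · exact .inl ⟨h1, h2⟩
    · exact .inr ⟨h1, h2⟩
  · rintro (⟨h1, h2⟩ | ⟨h1, h2⟩)
    · exact ⟨a, b, rfl, h1, h2⟩
    · exact ⟨b, a, Sym2.eq_swap, h1, h2⟩

theorem IsMedianGraph.separates_congr (hG : IsMedianGraph G) {e f : G.edgeSet}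
    (h : (thetaSetoid G).r e f) (u v : V) : Separates G e u v ↔ Separates G f u v := by
  change Relation.ReflTransGen (Theta0 G) e f at h
  induction h with
  | refl => rfl
  | tail _ hbc ih =>
    obtain ⟨a, b, x, y, he, hf, hs⟩ := hbc
    rw [ih, he, hf, separates_mk, separates_mk, hG.halfspace_eq_of_isSquare hs,
      hG.halfspace_eq_of_isSquare hs.swap]

/-- An edge crossing the cut is slid towards `ab` through squares. With `c'` the next vertex on a
geodesic from `c` to `a`, the quadrangle condition seen from `b` closes `c'`, `c`, `d` into a square
whose side opposite `cd` crosses the same cut closer to `a`. -/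
theorem IsMedianGraph.theta_of_mem_halfspace (hG : IsMedianGraph G) {a b : V} (hab : G.Adj a b) :
    ∀ (n : ℕ) {c d : V} (hcd : G.Adj c d), G.dist c a = n → c ∈ halfspace G a b →
      d ∈ halfspace G b a → (thetaSetoid G).r ⟨s(a, b), hab⟩ ⟨s(c, d), hcd⟩ := by
  intro n
  induction n with
  | zero =>
    intro c d hcd hn hc hd
    obtain rfl := hG.connected.dist_eq_zero_iff.mp hn
    have h1 := SimpleGraph.dist_eq_one_iff_adj.mpr hcd.symm
    have : G.dist d b = 0 := by
      simp only [halfspace, Set.mem_ofPred_eq] at hd; omega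
    obtain rfl := hG.connected.dist_eq_zero_iff.mp this
    exact Relation.ReflTransGen.refl
  | succ n ih =>
    intro c d hcd hn hc hd
    simp only [halfspace, Set.mem_ofPred_eq] at hc hd
    obtain ⟨c', hcc', hn'⟩ := exists_adj_dist_eq hG.connected hn
    have h1 := hG.dist_adj hab c
    have h2 := hG.dist_adj hab d
    have h3 := hG.dist_adj hcd a
    have h4 := hG.dist_adj hcd b
    have h5 := hG.dist_adj hcc' b
    have h6 := hG.dist_adj hab c'
    simp only [G.dist_comm (u := a), G.dist_comm (u := b)] at h3 h4 h5
    obtain ⟨d', hc'd', hd'd, ht⟩ := hG.quadrangle (x := b) (n := n + 1) hcc'.symm hcd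
      (by rintro rfl; omega) (by rw [G.dist_comm]; omega) (by rw [G.dist_comm]; omega)
      (by rw [G.dist_comm]; omega)
    rw [G.dist_comm] at ht
    have h7 := hG.dist_adj hd'd a
    have h8 := hG.dist_adj hab d'
    simp only [G.dist_comm (u := a)] at h7
    have hs : IsSquare G c' d' d c := ⟨hc'd', hd'd, hcd.symm, hcc', by rintro rfl; omega,
      by rintro rfl; omega⟩
    exact Relation.ReflTransGen.tail
      (ih hc'd' hn' (by simp only [halfspace, Set.mem_ofPred_eq]; omega)
        (by simp only [halfspace, Set.mem_ofPred_eq]; omega))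
      ⟨c', d', c, d, rfl, rfl, hs⟩

theorem self_mem_halfspace {a b : V} (hab : G.Adj a b) : a ∈ halfspace G a b := by
  simp [halfspace, SimpleGraph.dist_eq_one_iff_adj.mpr hab]

theorem separates_self {a b : V} (hab : G.Adj a b) : Separates G s(a, b) a b :=
  ⟨a, b, rfl, self_mem_halfspace hab, self_mem_halfspace hab.symm⟩

/-- The class of an edge. -/
def edgeClass {a b : V} (hab : G.Adj a b) : ThetaClass G :=
  Quotient.mk (thetaSetoid G) ⟨s(a, b), hab⟩

theorem exists_edgeClass_eq (E : ThetaClass G) : ∃ a b, ∃ hab : G.Adj a b, edgeClass hab = E := by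
  obtain ⟨⟨e, he⟩, rfl⟩ := Quotient.exists_rep E
  induction e with | h a b => exact ⟨a, b, he, rfl⟩

theorem mk_mem_edges_iff {u v : V} {E : ThetaClass G} :
    s(u, v) ∈ E.edges ↔ ∃ h : G.Adj u v, edgeClass h = E := Iff.rfl

theorem IsMedianGraph.mk_mem_edges_edgeClass (hG : IsMedianGraph G) {a b : V} (hab : G.Adj a b)
    {u v : V} : s(u, v) ∈ (edgeClass hab).edges ↔ G.Adj u v ∧ Separates G s(a, b) u v := by
  constructor
  · rintro ⟨h, he⟩
    exact ⟨h, (hG.separates_congr (Quotient.exact he) u v).mp (separates_self h)⟩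
  · rintro ⟨h, hs⟩
    refine ⟨h, Quotient.sound ((thetaSetoid G).symm ?_)⟩
    rcases separates_mk.mp hs with ⟨h1, h2⟩ | ⟨h1, h2⟩
    · exact hG.theta_of_mem_halfspace hab _ h rfl h1 h2
    · have := hG.theta_of_mem_halfspace hab _ h.symm rfl h2 h1
      simpa only [Sym2.eq_swap (a := v)] using this

theorem IsMedianGraph.separates_iff (hG : IsMedianGraph G) {a b : V} (hab : G.Adj a b) {u v : V} :
    Separates G s(a, b) u v ↔ ¬ (u ∈ halfspace G a b ↔ v ∈ halfspace G a b) := by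
  rw [separates_mk, hG.mem_halfspace_swap hab, hG.mem_halfspace_swap hab]
  tauto

/-- A geodesic to `a` stays in the half-space of `a`, hence avoids the class. With its mirror image
this makes both sides of the cut connected after deletion. -/
theorem IsMedianGraph.reachable_of_mem_halfspace (hG : IsMedianGraph G) {a b : V}
    (hab : G.Adj a b) : ∀ (n : ℕ) {c : V}, G.dist c a = n → c ∈ halfspace G a b →
      (G.deleteEdges (edgeClass hab).edges).Reachable c a := by
  intro n
  induction n with
  | zero =>
    intro c hn _
    obtain rfl := hG.connected.dist_eq_zero_iff.mp hn
    rfl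
  | succ n ih =>
    intro c hn hc
    obtain ⟨c', hcc', hn'⟩ := exists_adj_dist_eq hG.connected hn
    have hc' : c' ∈ halfspace G a b := by
      simp only [halfspace, Set.mem_ofPred_eq] at hc ⊢
      have h5 := hG.dist_adj hcc' b
      simp only [G.dist_comm (u := b)] at h5
      omega
    refine SimpleGraph.Reachable.trans (SimpleGraph.Adj.reachable ?_) (ih hn' hc')
    rw [SimpleGraph.deleteEdges_adj, hG.mk_mem_edges_edgeClass, hG.separates_iff hab]
    tauto

theorem IsMedianGraph.reachable_deleteEdges_iff (hG : IsMedianGraph G) {a b : V} (hab : G.Adj a b)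
    {u v : V} : (G.deleteEdges (edgeClass hab).edges).Reachable u v ↔
      (u ∈ halfspace G a b ↔ v ∈ halfspace G a b) := by
  constructor
  · rintro ⟨p⟩
    induction p with
    | nil => rfl
    | cons h _ ih =>
      rw [SimpleGraph.deleteEdges_adj, hG.mk_mem_edges_edgeClass, hG.separates_iff hab] at h
      tauto
  · intro h
    by_cases hu : u ∈ halfspace G a b
    · exact (hG.reachable_of_mem_halfspace hab _ rfl hu).trans
        (hG.reachable_of_mem_halfspace hab _ rfl (h.mp hu)).symm
    · have hv := mt h.mpr hu
      rw [← hG.mem_halfspace_swap hab] at hu hv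
      have key : edgeClass hab = edgeClass hab.symm := by
        exact congrArg _ (Subtype.ext Sym2.eq_swap)
      rw [key]
      exact (hG.reachable_of_mem_halfspace hab.symm _ rfl hu).trans
        (hG.reachable_of_mem_halfspace hab.symm _ rfl hv).symm

/-! ### Signatures as set coordinates: distance, intervals, orientation, medians. -/

theorem IsMedianGraph.edgeClass_mem_signature_iff (hG : IsMedianGraph G) {a b : V}
    (hab : G.Adj a b) {u v : V} : edgeClass hab ∈ signature G u v ↔
      ¬ (u ∈ halfspace G a b ↔ v ∈ halfspace G a b) :=
  not_congr (hG.reachable_deleteEdges_iff hab)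

theorem IsMedianGraph.mem_edges_iff (hG : IsMedianGraph G) {u v : V} {E : ThetaClass G} :
    s(u, v) ∈ E.edges ↔ G.Adj u v ∧ E ∈ signature G u v := by
  obtain ⟨a, b, hab, rfl⟩ := exists_edgeClass_eq E
  rw [hG.mk_mem_edges_edgeClass, hG.edgeClass_mem_signature_iff, hG.separates_iff hab]

theorem IsMedianGraph.signature_eq_symmDiff (hG : IsMedianGraph G) (o u v : V) :
    signature G u v = symmDiff (signature G o u) (signature G o v) := by
  ext E
  obtain ⟨a, b, hab, rfl⟩ := exists_edgeClass_eq E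
  simp only [Set.mem_symmDiff, hG.edgeClass_mem_signature_iff]
  tauto

theorem signature_comm (u v : V) : signature G u v = signature G v u := by
  ext E
  exact not_congr ⟨fun h => h.symm, fun h => h.symm⟩

theorem IsMedianGraph.signature_of_adj (hG : IsMedianGraph G) {u v : V} (h : G.Adj u v) :
    signature G u v = {edgeClass h} := by
  ext E
  rw [Set.mem_singleton_iff]
  constructor
  · intro hE
    obtain ⟨_, h2⟩ := mk_mem_edges_iff.mp (hG.mem_edges_iff.mpr ⟨h, hE⟩)
    exact h2.symm
  · rintro rfl
    exact (hG.mem_edges_iff.mp ⟨h, rfl⟩).2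

instance [Finite V] : Finite (ThetaClass G) :=
  inferInstanceAs (Finite (Quotient (thetaSetoid G)))

theorem IsMedianGraph.mem_signature_trans (hG : IsMedianGraph G) (o u v : V) (E : ThetaClass G) :
    E ∈ signature G u v ↔ ¬ (E ∈ signature G o u ↔ E ∈ signature G o v) := by
  rw [hG.signature_eq_symmDiff o u v, Set.mem_symmDiff]
  tauto

theorem signature_self (u : V) : signature G u u = ∅ := by
  ext E
  simp [signature]

/-- Along a geodesic each edge contributes a new class: after the first edge `uw`, both `w` and `v`
are on the side of `w`, so its class does not separate them. -/
theorem IsMedianGraph.ncard_signature [Finite V] (hG : IsMedianGraph G) :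
    ∀ u v : V, (signature G u v).ncard = G.dist u v := by
  suffices h : ∀ (n : ℕ) (u v : V), G.dist u v = n → (signature G u v).ncard = n from
    fun u v => h _ u v rfl
  intro n
  induction n with
  | zero =>
    intro u v h
    obtain rfl := hG.connected.dist_eq_zero_iff.mp h
    rw [signature_self, Set.ncard_empty]
  | succ n ih =>
    intro u v h
    obtain ⟨w, huw, hw⟩ := exists_adj_dist_eq hG.connected h
    have hE : edgeClass huw ∉ signature G w v := by
      rw [hG.edgeClass_mem_signature_iff, not_not]
      have h1 := SimpleGraph.dist_eq_one_iff_adj.mpr huw.symm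
      simp only [halfspace, Set.mem_ofPred_eq, G.dist_comm (u := v), SimpleGraph.dist_self]
      omega
    have : signature G u v = insert (edgeClass huw) (signature G w v) := by
      ext F
      have h1 := hG.mem_signature_trans w u v F
      rw [signature_comm w u, hG.signature_of_adj huw, Set.mem_singleton_iff] at h1
      rw [h1, Set.mem_insert_iff]
      by_cases hF : F = edgeClass huw
      · subst hF; tauto
      · tauto
    rw [this, Set.ncard_insert_of_notMem hE (Set.toFinite _), ih _ _ hw]

theorem IsMedianGraph.eq_of_signature_eq_empty (hG : IsMedianGraph G) [Finite V] {u v : V}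
    (h : signature G u v = ∅) : u = v := by
  rw [← hG.connected.dist_eq_zero_iff, ← hG.ncard_signature, h, Set.ncard_empty]

theorem IsMedianGraph.eq_of_signature_eq (hG : IsMedianGraph G) [Finite V] {o u v : V}
    (h : signature G o u = signature G o v) : u = v := by
  apply hG.eq_of_signature_eq_empty
  rw [hG.signature_eq_symmDiff o, h, symmDiff_self, Set.bot_eq_empty]

theorem IsMedianGraph.adj_iff (hG : IsMedianGraph G) [Finite V] {u v : V} :
    G.Adj u v ↔ ∃ E, signature G u v = {E} := by
  rw [← SimpleGraph.dist_eq_one_iff_adj, ← hG.ncard_signature, Set.ncard_eq_one]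

theorem IsMedianGraph.adj_of_signature (hG : IsMedianGraph G) [Finite V] {u v : V}
    {E : ThetaClass G} (h : signature G u v = {E}) : G.Adj u v :=
  hG.adj_iff.mpr ⟨E, h⟩

theorem IsMedianGraph.mem_edges_iff_signature (hG : IsMedianGraph G) [Finite V] {u v : V}
    {E : ThetaClass G} : s(u, v) ∈ E.edges ↔ signature G u v = {E} := by
  rw [hG.mem_edges_iff, hG.adj_iff]
  constructor
  · rintro ⟨⟨F, hF⟩, hE⟩
    rw [hF, Set.mem_singleton_iff] at hE
    rw [hF, hE]
  · intro h
    exact ⟨⟨E, h⟩, h ▸ rfl⟩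

/-- The signature of `(u,v)` is the symmetric difference of those of `(u,x)` and `(x,v)`, and
cardinalities add up exactly when these two are disjoint. -/
theorem IsMedianGraph.mem_interval_iff (hG : IsMedianGraph G) [Finite V] {u x v : V} :
    x ∈ interval G u v ↔ signature G u x ⊆ signature G u v := by
  simp only [interval, Set.mem_ofPred_eq, ← hG.ncard_signature]
  have key : signature G u v = symmDiff (signature G u x) (signature G x v) := by
    rw [signature_comm u x]; exact hG.signature_eq_symmDiff x u v
  constructor
  · intro h
    have h1 : signature G u v ⊆ signature G u x ∪ signature G x v := by
      rw [key]; exact symmDiff_le_sup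
    have h2 := Set.ncard_le_ncard h1 (Set.toFinite _)
    have h3 := Set.ncard_union_add_ncard_inter (signature G u x) (signature G x v)
    have h4 : signature G u v = signature G u x ∪ signature G x v :=
      Set.eq_of_subset_of_ncard_le h1 (by omega)
    rw [h4]; exact Set.subset_union_left
  · intro h
    have h1 : signature G x v = signature G u v \ signature G u x := by
      rw [hG.signature_eq_symmDiff u x v, symmDiff_of_le h]
    rw [h1, add_comm]
    exact Set.ncard_sdiff_add_ncard_of_subset h

theorem IsMedianGraph.dist_lt_iff (hG : IsMedianGraph G) (o : V) {u w : V} (h : G.Adj u w)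
    {E : ThetaClass G} (hE : E ∈ signature G u w) :
    G.dist o u < G.dist o w ↔ E ∉ signature G o u := by
  rw [hG.signature_of_adj h, Set.mem_singleton_iff] at hE
  subst hE
  rw [hG.edgeClass_mem_signature_iff, not_not]
  have := self_mem_halfspace h
  simp only [this, iff_true]
  rfl

/-- Lying in an interval forces agreement with its ends on every class that does not separate them,
and of three vertices two always agree. -/
theorem IsMedianGraph.exists_majority (hG : IsMedianGraph G) [Finite V] (o x y z : V) :
    ∃ m, ∀ E, E ∈ signature G o m ↔
      (E ∈ signature G o x ∧ E ∈ signature G o y) ∨ (E ∈ signature G o y ∧ E ∈ signature G o z) ∨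
        (E ∈ signature G o z ∧ E ∈ signature G o x) := by
  obtain ⟨m, ⟨⟨h1, h2⟩, h3⟩, -⟩ := hG.existsUnique_median x y z
  refine ⟨m, fun E => ?_⟩
  have k1 : E ∈ signature G x m → E ∈ signature G x y := fun h => hG.mem_interval_iff.mp h1 h
  have k2 : E ∈ signature G y m → E ∈ signature G y z := fun h => hG.mem_interval_iff.mp h2 h
  have k3 : E ∈ signature G z m → E ∈ signature G z x := fun h => hG.mem_interval_iff.mp h3 h
  simp only [hG.mem_signature_trans o x, hG.mem_signature_trans o y,
    hG.mem_signature_trans o z] at k1 k2 k3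
  tauto

/-! ### Orthogonal families and hypercubes. -/

/-- The four corners of the square realise all four positions relative to `E` and `F`, so one of
them lies opposite `o` for both. -/
theorem IsMedianGraph.exists_of_orthogonal (hG : IsMedianGraph G) [Finite V] {E F : ThetaClass G}
    (h : Orthogonal E F) (o : V) : ∃ w, E ∈ signature G o w ∧ F ∈ signature G o w := by
  obtain ⟨u, v, y, x, hs, h1, h2, h3, h4⟩ := h
  rw [hG.mem_edges_iff_signature] at h1 h2 h3 h4
  have hne : E ≠ F := by
    rintro rfl
    exact hs.ne_bd (hG.eq_of_signature_eq (h1.trans h3.symm))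
  have e1 := hG.mem_signature_trans o u v
  have e2 := hG.mem_signature_trans o x y
  have e3 := hG.mem_signature_trans o u x
  have e4 := hG.mem_signature_trans o v y
  simp only [h1, h2, h3, h4, Set.mem_singleton_iff] at e1 e2 e3 e4
  have a1 := e1 E
  have a3 := e3 E
  have a4 := e4 E
  have b1 := e1 F
  have b3 := e3 F
  have b4 := e4 F
  clear e1 e2 e3 e4
  simp only [hne, hne.symm, true_iff, false_iff, not_not] at a1 a3 a4 b1 b3 b4
  by_cases hE : E ∈ signature G o u <;> by_cases hF : F ∈ signature G o u
  · exact ⟨u, hE, hF⟩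
  · exact ⟨x, a3.mp hE, by tauto⟩
  · exact ⟨v, by tauto, b1.mp hF⟩
  · exact ⟨y, a4.mp (by tauto), by tauto⟩

theorem IsMedianGraph.orthogonal_of_signature (hG : IsMedianGraph G) [Finite V] {b u v w : V}
    {E F : ThetaClass G} (hne : E ≠ F) (hu : signature G b u = {E}) (hv : signature G b v = {F})
    (hw : signature G b w = {E, F}) : Orthogonal E F := by
  have huw : signature G u w = {F} := by
    ext K
    rw [hG.mem_signature_trans b, hu, hw]
    simp only [Set.mem_singleton_iff, Set.mem_insert_iff]
    by_cases h : K = E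
    · subst h; simp [hne]
    · simp [h]
  have hvw : signature G v w = {E} := by
    ext K
    rw [hG.mem_signature_trans b, hv, hw]
    simp only [Set.mem_singleton_iff, Set.mem_insert_iff]
    by_cases h : K = F
    · subst h; simp [hne.symm]
    · simp [h]
  refine ⟨b, u, w, v, ⟨hG.adj_of_signature hu, hG.adj_of_signature huw,
    (hG.adj_of_signature hvw).symm, (hG.adj_of_signature hv).symm, ?_, ?_⟩, ?_, ?_, ?_, ?_⟩
  · rintro rfl
    rw [signature_self] at hw
    exact (Set.insert_nonempty E {F}).ne_empty hw.symm
  · rintro rfl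
    exact hne (Set.singleton_injective (hu.symm.trans hv))
  all_goals rwa [hG.mem_edges_iff_signature]

/-- At a vertex incident to all the classes of a POF, every subset of the POF can be flipped. -/
theorem IsMedianGraph.exists_signature_eq (hG : IsMedianGraph G) [Finite V] {L : Set (ThetaClass G)}
    (hL : IsPOF L) {b : V} (hb : ∀ E ∈ L, ∃ w, s(b, w) ∈ E.edges) :
    ∀ M ⊆ L, ∃ w, signature G b w = M := by
  suffices h : ∀ (n : ℕ) (M : Set (ThetaClass G)), M.ncard = n → M ⊆ L → ∃ w, signature G b w = M
    from fun M hM => h _ M rfl hM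
  intro n
  induction n using Nat.strong_induction_on with
  | _ n ih =>
    intro M hn hM
    rcases M.eq_empty_or_nonempty with rfl | ⟨E, hE⟩
    · exact ⟨b, signature_self b⟩
    have sub : ∀ K ∈ M, ∃ w, signature G b w = M \ {K} := fun K hK =>
      ih _ (by rw [← hn]; exact Set.ncard_sdiff_singleton_lt_of_mem hK (Set.toFinite _)) _ rfl
        (Set.sdiff_subset.trans hM)
    by_cases h1 : M = {E}
    · obtain ⟨w, hw⟩ := hb E (hM hE)
      exact ⟨w, h1 ▸ hG.mem_edges_iff_signature.mp hw⟩
    obtain ⟨F, hF, hFE⟩ : ∃ F ∈ M, F ≠ E := by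
      by_contra hcon
      push Not at hcon
      exact h1 (Set.eq_singleton_iff_unique_mem.mpr ⟨hE, hcon⟩)
    obtain ⟨x, hx⟩ := sub E hE
    obtain ⟨y, hy⟩ := sub F hF
    -- In the majority of `x`, `y`, `z`, the vertex `z` restores `E` (with `y`) and `F` (with `x`).
    -- On all other classes `x` and `y` already agree with `M` and outvote `z`.
    obtain ⟨z, hz⟩ := hG.exists_of_orthogonal (hL (hM hE) (hM hF) hFE.symm) b
    obtain ⟨m, hm⟩ := hG.exists_majority b x y z
    refine ⟨m, ?_⟩
    ext K
    rw [hm, hx, hy]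
    simp only [Set.mem_sdiff, Set.mem_singleton_iff]
    by_cases hKE : K = E
    · subst hKE; have := hFE.symm; tauto
    by_cases hKF : K = F
    · subst hKF; tauto
    tauto

theorem IsMedianGraph.isHypercube (hG : IsMedianGraph G) [Finite V] {b : V}
    {L : Set (ThetaClass G)} (hL : ∀ M ⊆ L, ∃ w, signature G b w = M) :
    IsHypercube G {w | signature G b w ⊆ L} := by
  obtain ⟨k, ⟨e⟩⟩ := Finite.exists_equiv_fin L
  let g : Fin k → ThetaClass G := fun i => (e.symm i : ThetaClass G)
  have hg : Function.Injective g := Subtype.val_injective.comp e.symm.injective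
  have hgL : ∀ A : Finset (Fin k), g '' A ⊆ L := by
    rintro A _ ⟨i, -, rfl⟩
    exact (e.symm i).2
  choose f hf using fun A : Finset (Fin k) => hL _ (hgL A)
  have hadj : ∀ A B, G.Adj (f A) (f B) ↔ (symmDiff A B).card = 1 := by
    intro A B
    rw [← SimpleGraph.dist_eq_one_iff_adj, ← hG.ncard_signature, hG.signature_eq_symmDiff b, hf, hf,
      ← Set.image_symmDiff hg, ← Finset.coe_symmDiff, Set.ncard_image_of_injective _ hg,
      Set.ncard_coe_finset]
  let F : Finset (Fin k) → {w | signature G b w ⊆ L} := fun A => ⟨f A, (hf A).trans_subset (hgL A)⟩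
  have hF : Function.Bijective F := by
    constructor
    · intro A B h
      have h1 : f A = f B := congrArg Subtype.val h
      have h2 := (hf A).symm.trans (h1 ▸ hf B)
      exact Finset.coe_injective (hg.image_injective h2)
    · rintro ⟨w, hw⟩
      refine ⟨(Set.toFinite (g ⁻¹' signature G b w)).toFinset, Subtype.ext ?_⟩
      apply hG.eq_of_signature_eq (o := b)
      rw [hf, Set.Finite.coe_toFinset, Set.image_preimage_eq_iff]
      intro E hE
      exact ⟨e ⟨E, hw hE⟩, by simp [g]⟩
  exact ⟨k, ⟨⟨Equiv.ofBijective F hF, fun {A B} => hadj A B⟩⟩⟩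

theorem IsMedianGraph.hypercubeBetween (hG : IsMedianGraph G) [Finite V] {v₀ b a : V}
    {L : Set (ThetaClass G)} (hL : ∀ M ⊆ L, ∃ w, signature G b w = M)
    (hout : ∀ E ∈ L, E ∉ signature G v₀ b) (ha : signature G b a = L) :
    HypercubeBetween G v₀ L b a := by
  refine ⟨{w | signature G b w ⊆ L}, hG.isHypercube hL, ?_, ⟨?_, ?_⟩, ⟨ha.subset, ?_⟩⟩
  · ext E
    constructor
    · rintro ⟨x, hx, y, hy, hxy⟩
      have h1 : E ∈ signature G x y := by rw [hG.mem_edges_iff_signature.mp hxy]; rfl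
      rw [hG.mem_signature_trans b] at h1
      by_contra hE
      exact h1 (iff_of_false (fun h => hE (hx h)) (fun h => hE (hy h)))
    · intro hE
      obtain ⟨w, hw⟩ := hL {E} (Set.singleton_subset_iff.mpr hE)
      refine ⟨b, ?_, w, ?_, hG.mem_edges_iff_signature.mpr hw⟩
      · change signature G b b ⊆ L
        rw [signature_self]; exact Set.empty_subset _
      · exact hw.trans_subset (Set.singleton_subset_iff.mpr hE)
  · change signature G b b ⊆ L
    rw [signature_self]; exact Set.empty_subset _
  · intro w hw hadj
    obtain ⟨E, hE⟩ := hG.adj_iff.mp hadj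
    have hE' : E ∈ signature G b w := hE ▸ rfl
    exact (hG.dist_lt_iff v₀ hadj hE').mpr (hout E (hw hE'))
  · intro w hw hadj
    obtain ⟨E, hE⟩ := hG.adj_iff.mp hadj.symm
    have hE' : E ∈ signature G w a := hE ▸ rfl
    rw [hG.dist_lt_iff v₀ hadj.symm hE']
    have hEL : E ∈ L := by
      have h1 := hG.mem_signature_trans b w a E
      rw [ha] at h1
      have h2 : E ∈ signature G b w → E ∈ L := fun h => hw h
      tauto
    have h1 := hG.mem_signature_trans b w a E
    have h2 := hG.mem_signature_trans v₀ b w E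
    have h3 := hout E hEL
    rw [ha] at h1
    tauto

/-- Makes the anti-basis of a cube depend only on its basis and its classes: an abstract induced
cube is shown to have the expected coordinates, subsets of directions at `b` corresponding to sets
of classes. -/
theorem IsMedianGraph.signature_of_hypercubeBetween (hG : IsMedianGraph G) [Finite V] {v₀ b a : V}
    {X : Set (ThetaClass G)} (h : HypercubeBetween G v₀ X b a) : signature G b a = X := by
  obtain ⟨Q, ⟨k, ⟨f⟩⟩, rfl, ⟨hbQ, hb⟩, ⟨haQ, ha⟩⟩ := h
  obtain ⟨B, hB⟩ := f.surjective ⟨b, hbQ⟩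
  -- Translating by `B` sends the empty set to the basis.
  let F : Finset (Fin k) → V := fun M => (f (symmDiff B M)).1
  have hFQ : ∀ M, F M ∈ Q := fun M => (f _).2
  have hFs : ∀ x ∈ Q, ∃ M, F M = x := by
    intro x hx
    obtain ⟨A, hA⟩ := f.surjective ⟨x, hx⟩
    exact ⟨symmDiff B A, by simp only [F, symmDiff_symmDiff_cancel_left, hA]⟩
  have hF0 : F ∅ = b := by
    have : symmDiff B ∅ = B := symmDiff_bot B
    simp only [F, this, hB]
  have hFi : Function.Injective F := by
    intro M N h
    exact symmDiff_right_injective B (f.injective (Subtype.ext h))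
  have hadj : ∀ M N, (symmDiff M N).card = 1 → G.Adj (F M) (F N) := by
    intro M N h
    have h1 : (hypercube k).Adj (symmDiff B M) (symmDiff B N) := by
      change (symmDiff (symmDiff B M) (symmDiff B N)).card = 1
      rwa [symmDiff_symmDiff_symmDiff_comm, symmDiff_self, bot_symmDiff]
    exact f.map_rel_iff.mpr h1
  have hadj' : ∀ M i, i ∈ M → G.Adj (F (M.erase i)) (F M) := by
    intro M i hi
    apply hadj
    rw [symmDiff_of_le (Finset.erase_subset i M)]
    rw [Finset.card_sdiff_of_subset (Finset.erase_subset i M), Finset.card_erase_of_mem hi]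
    have := Finset.card_pos.mpr ⟨i, hi⟩
    omega
  have hsingle : ∀ i, G.Adj b (F {i}) := by
    intro i
    have := hadj' {i} i (Finset.mem_singleton_self i)
    rwa [Finset.erase_singleton, hF0] at this
  choose E hE using fun i => hG.adj_iff.mp (hsingle i)
  have hEi : Function.Injective E := by
    intro i j hij
    have := hG.eq_of_signature_eq ((hE i).trans (hij ▸ (hE j).symm))
    exact Finset.singleton_injective (hFi this)
  have hmem : ∀ (M : Finset (Fin k)) i, E i ∈ E '' (M : Set (Fin k)) ↔ i ∈ M := fun M i => by
    rw [hEi.mem_set_image, Finset.mem_coe]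
  have key : ∀ (n : ℕ) (M : Finset (Fin k)), M.card = n → signature G b (F M) = E '' M := by
    intro n
    induction n using Nat.strong_induction_on with
    | _ n ih =>
      intro M hn
      rcases M.eq_empty_or_nonempty with rfl | ⟨i, hi⟩
      · rw [hF0, signature_self, Finset.coe_empty, Set.image_empty]
      by_cases h1 : M = {i}
      · rw [h1, hE, Finset.coe_singleton, Set.image_singleton]
      obtain ⟨j, hj, hji⟩ : ∃ j ∈ M, j ≠ i := by
        by_contra hcon
        push Not at hcon
        exact h1 (Finset.eq_singleton_iff_unique_mem.mpr ⟨hi, hcon⟩)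
      have lt : ∀ l ∈ M, (M.erase l).card < n := fun l hl => hn ▸ Finset.card_erase_lt_of_mem hl
      have s1 := ih _ (lt i hi) _ rfl
      have s2 := ih _ (lt j hj) _ rfl
      have s0 := ih _ ((Finset.card_erase_le (a := j)).trans_lt (lt i hi)) _ rfl
      obtain ⟨K, hK⟩ := hG.adj_iff.mp (hadj' M i hi)
      obtain ⟨K', hK'⟩ := hG.adj_iff.mp (hadj' M j hj)
      have m1 := fun J => hG.mem_signature_trans b (F (M.erase i)) (F M) J
      have m2 := fun J => hG.mem_signature_trans b (F (M.erase j)) (F M) J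
      simp only [s1, hK, Set.mem_singleton_iff] at m1
      simp only [s2, hK', Set.mem_singleton_iff] at m2
      -- Parallel edges of the cube have the same class: otherwise comparing the two ways into `F
      -- M`, through `M.erase i` and `M.erase j`, forces `F M` to coincide with the opposite corner
      -- of that square.
      have hKi : K = E i := by
        by_contra hne
        have a1 := m1 (E i)
        have a2 := m2 (E i)
        have b1 := m1 (E j)
        have b2 := m2 (E j)
        simp only [hmem, Finset.mem_erase, hi, hj, hji, hji.symm, ne_eq, not_true, not_false_eq_true,
          and_true, true_iff, false_iff, not_not, and_self] at a1 a2 b1 b2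
        have hK'i : E i = K' := a2.mpr (by rw [← a1]; exact Ne.symm hne)
        have hKj : E j = K := by
          rw [b1, ← b2, ← hK'i]; exact hEi.ne hji
        have : F M = F ((M.erase i).erase j) := by
          apply hG.eq_of_signature_eq (o := b)
          rw [s0]
          ext J
          have c := m1 J
          by_cases hJ : J = E j
          · subst hJ
            simp only [hmem, Finset.mem_erase]
            simp only [ne_eq, not_true, false_and, iff_false]
            exact b1.mp hKj
          · have c' : J ∉ ({K} : Set _) := by rw [← hKj]; exact hJ
            rw [Set.mem_singleton_iff] at c'
            simp only [c', false_iff, not_not] at c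
            rw [← c, Finset.coe_erase j (M.erase i), Set.image_sdiff hEi, Set.image_singleton]
            simp [hJ]
        have := hFi this
        exact absurd hi (by rw [this]; simp)
      subst hKi
      ext J
      have c := m1 J
      by_cases hJ : J = E i
      · subst hJ
        simp only [hmem, Finset.mem_erase, ne_eq, not_true, false_and, true_iff, false_iff,
          not_not] at c ⊢
        exact iff_of_true c hi
      · simp only [hJ, false_iff, not_not] at c
        rw [← c, Finset.coe_erase, Set.image_sdiff hEi, Set.image_singleton]
        simp [hJ]
  have key := fun M => key _ M rfl
  obtain ⟨M, rfl⟩ := hFs a haQ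
  -- A direction missing from `M` would give an edge at the anti-basis of class `E i`, a class that
  -- does not separate `v₀` from `b`, hence an outgoing edge.
  have hM : ∀ i, i ∈ M := by
    intro i
    by_contra hi
    have h1 := hadj' (insert i M) i (Finset.mem_insert_self i M)
    rw [Finset.erase_insert hi] at h1
    have h2 : E i ∈ signature G (F M) (F (insert i M)) := by
      rw [hG.mem_signature_trans b, key, key, hmem, hmem]
      simp [hi]
    have h3 := ha _ (hFQ _) h1
    have h4 := (hG.dist_lt_iff v₀ (hsingle i) (E := E i) (by rw [hE i]; rfl)).mp
      (hb _ (hFQ _) (hsingle i))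
    have h5 := (not_congr (hG.dist_lt_iff v₀ h1 h2)).mp h3.not_gt
    have h6 := hG.mem_signature_trans v₀ b (F M) (E i)
    rw [key, hmem] at h6
    tauto
  rw [key]
  ext K
  constructor
  · rintro ⟨i, -, rfl⟩
    exact ⟨b, hbQ, F {i}, hFQ _, hG.mem_edges_iff_signature.mpr (hE i)⟩
  · rintro ⟨x, hx, y, hy, hxy⟩
    obtain ⟨N, rfl⟩ := hFs x hx
    obtain ⟨N', rfl⟩ := hFs y hy
    have h1 : K ∈ signature G (F N) (F N') := by rw [hG.mem_edges_iff_signature.mp hxy]; rfl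
    rw [hG.mem_signature_trans b, key, key] at h1
    have h2 : ∀ N : Finset (Fin k), K ∈ E '' (N : Set (Fin k)) → K ∈ E '' (M : Set (Fin k)) := by
      rintro N ⟨i, -, rfl⟩
      exact ⟨i, hM i, rfl⟩
    have := h2 N
    have := h2 N'
    tauto

/-! ### Ladder sets and the hypercubes at a vertex. -/

theorem IsMedianGraph.notMem_signature_of_mem_interval (hG : IsMedianGraph G) [Finite V]
    {v₀ u v : V} (hu : u ∈ interval G v₀ v) {E : ThetaClass G} (hE : E ∈ signature G u v) :
    E ∉ signature G v₀ u := by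
  have h1 : E ∈ signature G v₀ u → E ∈ signature G v₀ v := fun h => hG.mem_interval_iff.mp hu h
  rw [hG.mem_signature_trans v₀ u v] at hE
  tauto

theorem IsMedianGraph.isPOF_ladderSet (hG : IsMedianGraph G) [Finite V] (u v : V) :
    IsPOF (ladderSet G u v) := by
  rintro E ⟨hE, w, hw⟩ F ⟨hF, x, hx⟩ hne
  rw [hG.mem_edges_iff_signature] at hw hx
  -- The fourth corner of the square: `v` votes with `w` for `E` and with `x` for `F`, while every
  -- other class is rejected by both `w` and `x`.
  obtain ⟨m, hm⟩ := hG.exists_majority u w x v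
  refine hG.orthogonal_of_signature hne hw hx (w := m) ?_
  ext K
  rw [hm, hw, hx]
  simp only [Set.mem_singleton_iff, Set.mem_insert_iff]
  by_cases hKE : K = E
  · subst hKE; tauto
  by_cases hKF : K = F
  · subst hKF; tauto
  tauto

theorem IsMedianGraph.ladderSet_mem_outgoingPOFs (hG : IsMedianGraph G) [Finite V] {v₀ u v : V}
    (hu : u ∈ interval G v₀ v) : ladderSet G u v ∈ outgoingPOFs G v₀ u := by
  refine ⟨hG.isPOF_ladderSet u v, ?_⟩
  rintro E ⟨hE, w, hw⟩
  obtain ⟨hadj, hEw⟩ := hG.mem_edges_iff.mp hw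
  exact ⟨w, hw, (hG.dist_lt_iff v₀ hadj hEw).mpr (hG.notMem_signature_of_mem_interval hu hE)⟩

theorem IsMedianGraph.ladderSet_nonempty (hG : IsMedianGraph G) {u v : V} (hne : u ≠ v) :
    (ladderSet G u v).Nonempty := by
  obtain ⟨n, hn⟩ := Nat.exists_eq_succ_of_ne_zero (hG.connected.pos_dist_of_ne hne).ne'
  obtain ⟨w, hadj, hw⟩ := exists_adj_dist_eq hG.connected hn
  refine ⟨edgeClass hadj, ?_, w, hadj, rfl⟩
  rw [hG.edgeClass_mem_signature_iff]
  have h1 := self_mem_halfspace hadj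
  have h2 : v ∉ halfspace G u w := by
    simp only [halfspace, Set.mem_ofPred_eq, G.dist_comm (u := v)]
    omega
  tauto

theorem ladderSet_subset (u v : V) : ladderSet G u v ⊆ signature G u v := fun _ h => h.1

theorem IsMedianGraph.ladderSet_eq_signature (hG : IsMedianGraph G) [Finite V] {u v : V}
    (h : ∀ E ∈ signature G u v, ∃ w, signature G u w = {E}) :
    ladderSet G u v = signature G u v := by
  refine (ladderSet_subset u v).antisymm fun E hE => ⟨hE, ?_⟩
  obtain ⟨w, hw⟩ := h E hE
  exact ⟨w, hG.mem_edges_iff_signature.mpr hw⟩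

theorem IsMedianGraph.exists_hypercubeBetween_of_outgoing (hG : IsMedianGraph G) [Finite V]
    {v₀ u : V} {L : Set (ThetaClass G)} (hL : L ∈ outgoingPOFs G v₀ u) :
    ∃ a, HypercubeBetween G v₀ L u a ∧ signature G u a = L ∧ ladderSet G u a = L ∧
      u ∈ interval G v₀ a := by
  obtain ⟨hpof, hout⟩ := hL
  have hcube := hG.exists_signature_eq hpof (b := u) fun E hE => by
    obtain ⟨w, hw, -⟩ := hout E hE
    exact ⟨w, hw⟩
  have hnot : ∀ E ∈ L, E ∉ signature G v₀ u := by
    intro E hE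
    obtain ⟨w, hw, hlt⟩ := hout E hE
    obtain ⟨hadj, hEw⟩ := hG.mem_edges_iff.mp hw
    exact (hG.dist_lt_iff v₀ hadj hEw).mp hlt
  obtain ⟨a, ha⟩ := hcube L subset_rfl
  refine ⟨a, hG.hypercubeBetween hcube hnot ha, ha, ?_, ?_⟩
  · rw [hG.ladderSet_eq_signature, ha]
    intro E hE
    exact hcube {E} (Set.singleton_subset_iff.mpr (ha ▸ hE))
  · rw [hG.mem_interval_iff]
    intro E hE
    have h1 := mt (hnot E) (not_not.mpr hE)
    rw [← ha, hG.mem_signature_trans v₀] at h1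
    tauto

theorem IsMedianGraph.exists_hypercubeBetween_of_ingoing (hG : IsMedianGraph G) [Finite V]
    {v₀ u : V} {X : Set (ThetaClass G)} (hX : X ∈ ingoingPOFs G v₀ u) :
    ∃ b, HypercubeBetween G v₀ X b u ∧ signature G b u = X ∧ ladderSet G b u = X ∧
      b ∈ interval G v₀ u := by
  obtain ⟨hpof, hin⟩ := hX
  have hcube := hG.exists_signature_eq hpof (b := u) fun E hE => by
    obtain ⟨w, hw, -⟩ := hin E hE
    exact ⟨w, hw⟩
  obtain ⟨b, hb⟩ := hcube X subset_rfl
  have hbu : signature G b u = X := signature_comm b u ▸ hb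
  have hcube' : ∀ M ⊆ X, ∃ w, signature G b w = M := by
    intro M hM
    -- Since `b` is `u` with all of `X` flipped, flipping `M` from `b` amounts to flipping the
    -- complement from `u`.
    obtain ⟨w, hw⟩ := hcube (X \ M) Set.sdiff_subset
    refine ⟨w, ?_⟩
    ext E
    rw [hG.mem_signature_trans u, hb, hw, Set.mem_sdiff]
    have : E ∈ M → E ∈ X := fun h => hM h
    tauto
  have hnot : ∀ E ∈ X, E ∉ signature G v₀ b := by
    intro E hE
    obtain ⟨w, hw, hlt⟩ := hin E hE
    obtain ⟨hadj, hEw⟩ := hG.mem_edges_iff.mp hw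
    have h1 := (hG.dist_lt_iff v₀ hadj.symm (signature_comm u w ▸ hEw)).mp hlt
    rw [hG.mem_signature_trans v₀] at hEw
    rw [← hbu, hG.mem_signature_trans v₀] at hE
    tauto
  refine ⟨b, hG.hypercubeBetween hcube' hnot hbu, hbu, ?_, ?_⟩
  · rw [hG.ladderSet_eq_signature, hbu]
    intro E hE
    exact hcube' {E} (Set.singleton_subset_iff.mpr (hbu ▸ hE))
  · rw [hG.mem_interval_iff]
    intro E hE
    have h1 := mt (hnot E) (not_not.mpr hE)
    rw [← hbu, hG.mem_signature_trans v₀] at h1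
    tauto

theorem IsMedianGraph.isIngoing_of_signature_eq (hG : IsMedianGraph G) [Finite V] {v₀ b a : V}
    {L : Set (ThetaClass G)} (h : signature G b a = L)
    (hL : ∀ E ∈ L, E ∉ signature G v₀ b) (hcube : ∀ M ⊆ L, ∃ w, signature G b w = M) :
    IsIngoing v₀ a L := by
  intro E hE
  obtain ⟨w, hw⟩ := hcube (L \ {E}) Set.sdiff_subset
  have hwa : signature G w a = {E} := by
    ext F
    rw [hG.mem_signature_trans b, hw, h, Set.mem_sdiff]
    by_cases hF : F = E
    · subst hF; simp [hE]
    · simp [hF]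
  have hadj := hG.adj_of_signature hwa
  have hEw : E ∈ signature G w a := hwa ▸ rfl
  refine ⟨w, ?_, (hG.dist_lt_iff v₀ hadj hEw).mpr ?_⟩
  · rwa [hG.mem_edges_iff_signature, signature_comm]
  · have h1 := hG.mem_signature_trans v₀ b w E
    rw [hw, Set.mem_sdiff] at h1
    have h2 : E ∈ ({E} : Set (ThetaClass G)) := rfl
    have := hL E hE
    tauto

/-! ### Milestones and the penultimate milestone. -/

theorem IsMilestone.mem_interval {v₀ u v p : V} (h : IsMilestone G v₀ v u p) (hp : p ≠ v) :
    p ∈ interval G v₀ v := by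
  induction h with
  | first hu => exact hu
  | last => exact absurd rfl hp
  | step _ _ _ _ ih => exact ih hp

/-- The recursion grows the chain at its start; here it is prolonged at its far end. -/
theorem IsMilestone.extend {v₀ u v p p' : V} (h : IsMilestone G v₀ v u p) (hp : p ≠ v)
    (hcube : HypercubeBetween G v₀ (ladderSet G p v) p p') (hp' : p' ∈ interval G v₀ v)
    (hne : p' ≠ v) : IsMilestone G v₀ v u p' := by
  induction h with
  | first hu => exact .step hu hcube hne (.first hp')
  | last => exact absurd rfl hp
  | step hu hc hn _ ih => exact .step hu hc hn (ih hp hcube)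

/-- The next milestone after `p ≠ v` lies in `I(v₀,v)` and is strictly closer to `v`. -/
theorem IsMedianGraph.exists_next_milestone (hG : IsMedianGraph G) [Finite V] {v₀ p v : V}
    (hp : p ∈ interval G v₀ v) (hne : p ≠ v) :
    ∃ p', HypercubeBetween G v₀ (ladderSet G p v) p p' ∧ signature G p p' = ladderSet G p v ∧
      p' ∈ interval G v₀ v ∧ G.dist p' v < G.dist p v := by
  obtain ⟨p', hcube, hsig, -, -⟩ :=
    hG.exists_hypercubeBetween_of_outgoing (hG.ladderSet_mem_outgoingPOFs hp)
  have hmem : p' ∈ interval G p v := by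
    rw [hG.mem_interval_iff, hsig]; exact ladderSet_subset p v
  refine ⟨p', hcube, hsig, ?_, ?_⟩
  · simp only [interval, Set.mem_ofPred_eq] at hp hmem ⊢
    have h1 := hG.connected.dist_triangle (u := v₀) (v := p) (w := p')
    have h2 := hG.connected.dist_triangle (u := v₀) (v := p') (w := v)
    omega
  · simp only [interval, Set.mem_ofPred_eq] at hmem
    have h1 : p ≠ p' := by
      rintro rfl
      rw [signature_self] at hsig
      exact (hG.ladderSet_nonempty hne).ne_empty hsig.symm
    have := hG.connected.pos_dist_of_ne h1
    omega

theorem IsMedianGraph.isIngoing_ladderSet (hG : IsMedianGraph G) [Finite V] {v₀ p v : V}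
    (hp : p ∈ interval G v₀ v) (h : signature G p v = ladderSet G p v) :
    IsIngoing v₀ v (ladderSet G p v) :=
  hG.isIngoing_of_signature_eq h
    (fun _ hE => hG.notMem_signature_of_mem_interval hp hE.1)
    (hG.exists_signature_eq (hG.isPOF_ladderSet p v) fun _ hE => hE.2)

theorem IsMedianGraph.exists_isPenultimate (hG : IsMedianGraph G) [Finite V] {v₀ u v : V}
    (hu : u ∈ interval G v₀ v) (hne : u ≠ v) :
    ∃ p, ∃ X ∈ ingoingPOFs G v₀ v, HypercubeBetween G v₀ X p v ∧ IsPenultimate G v₀ u v p := by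
  obtain ⟨p, ⟨hp, hpv⟩, hmin⟩ := Set.exists_min_image {p | p ∈ milestones G v₀ u v ∧ p ≠ v}
    (fun p => G.dist p v) (Set.toFinite _) ⟨u, .first hu, hne⟩
  have hpI := IsMilestone.mem_interval hp hpv
  obtain ⟨p', hcube, hsig, hp', hlt⟩ := hG.exists_next_milestone hpI hpv
  -- Otherwise `p'` would be a milestone closer to `v` than the closest one. So the cube with ladder
  -- set of `(p,v)` ends at `v`.
  have hp'v : p' = v := by
    by_contra hcon
    exact hlt.not_ge (hmin p' ⟨IsMilestone.extend hp hpv hcube hp' hcon, hcon⟩)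
  subst hp'v
  exact ⟨p, _, ⟨hG.isPOF_ladderSet p p', hG.isIngoing_ladderSet hpI hsig⟩, hcube, hp, hpv,
    fun q hq hqv => hmin q ⟨hq, hqv⟩⟩

/-- When the ladder set is the whole signature, a single cube leads from `b` to `u` and the chain is
just `{b, u}`. -/
theorem IsMedianGraph.isPenultimate_of_hypercubeBetween (hG : IsMedianGraph G) [Finite V]
    {v₀ b u : V} (hb : b ∈ interval G v₀ u) (hne : b ≠ u)
    (h : ladderSet G b u = signature G b u) : IsPenultimate G v₀ b u b := by
  refine ⟨.first hb, hne, ?_⟩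
  intro q hq hqu
  change IsMilestone G v₀ u b q at hq
  cases hq with
  | first => exact le_rfl
  | last => exact absurd rfl hqu
  | step _ hcube hne' _ =>
    exact absurd (hG.eq_of_signature_eq ((hG.signature_of_hypercubeBetween hcube).trans h)) hne'

/-! ### Labels and eccentricity. -/

theorem IsMedianGraph.phiDistances_nonempty (hG : IsMedianGraph G) [Finite V] {v₀ u : V}
    {L : Set (ThetaClass G)} (hL : L ∈ outgoingPOFs G v₀ u) : (phiDistances G v₀ u L).Nonempty := by
  obtain ⟨a, -, -, h1, h2⟩ := hG.exists_hypercubeBetween_of_outgoing hL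
  exact ⟨_, a, h2, h1, rfl⟩

theorem IsMedianGraph.psiDistances_nonempty (hG : IsMedianGraph G) [Finite V] {v₀ u : V}
    {X : Set (ThetaClass G)} (hX : X ∈ ingoingPOFs G v₀ u) (hne : X.Nonempty) :
    (psiDistances G v₀ u X).Nonempty := by
  obtain ⟨b, hcube, hsig, hlad, hb⟩ := hG.exists_hypercubeBetween_of_ingoing hX
  have hbu : b ≠ u := by
    rintro rfl
    rw [signature_self] at hsig
    exact hne.ne_empty hsig.symm
  -- The basis `b` serves as the far vertex, as the median and as the penultimate milestone.
  refine ⟨_, b, b, b, ⟨⟨?_, ?_⟩, ?_⟩, hbu, hcube,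
    hG.isPenultimate_of_hypercubeBetween hb hbu (hlad.trans hsig.symm), rfl⟩
  · simp [interval]
  · simp [interval]
  · exact hb

theorem isGreatest_sSup_of_dist_le {u : V} [Finite V] {S : Set ℕ} (hS : S.Nonempty)
    (h : ∀ d ∈ S, ∃ v, d = G.dist u v) : IsGreatest S (sSup S) := by
  have hfin : S.Finite := (Set.finite_range (G.dist u)).subset fun d hd => by
    obtain ⟨v, rfl⟩ := h d hd
    exact ⟨v, rfl⟩
  exact ⟨Nat.sSup_mem hS hfin.bddAbove, fun d hd => le_csSup hfin.bddAbove hd⟩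

theorem exists_dist_of_mem_phiDistances {v₀ u : V} {L : Set (ThetaClass G)} :
    ∀ d ∈ phiDistances G v₀ u L, ∃ v, d = G.dist u v := by
  rintro d ⟨v, -, -, rfl⟩
  exact ⟨v, rfl⟩

theorem exists_dist_of_mem_psiDistances {v₀ u : V} {X : Set (ThetaClass G)} :
    ∀ d ∈ psiDistances G v₀ u X, ∃ v, d = G.dist u v := by
  rintro d ⟨v, -, -, -, -, -, -, rfl⟩
  exact ⟨v, rfl⟩

theorem psi_le {v₀ u : V} {n : ℕ} (h : ∀ v, G.dist u v ≤ n) (X : Set (ThetaClass G)) :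
    psi G v₀ u X ≤ n := by
  -- In `ℕ` the supremum of the empty set is `0`, so the bound also covers `X = ∅`.
  refine csSup_le' fun d hd => ?_
  obtain ⟨v, rfl⟩ := exists_dist_of_mem_psiDistances d hd
  exact h v

theorem phi_le {v₀ u : V} {n : ℕ} (h : ∀ v, G.dist u v ≤ n) (L : Set (ThetaClass G)) :
    phi G v₀ u L ≤ n := by
  refine csSup_le' fun d hd => ?_
  obtain ⟨v, rfl⟩ := exists_dist_of_mem_phiDistances d hd
  exact h v

theorem IsMedianGraph.dist_le_label (hG : IsMedianGraph G) [Finite V] (v₀ u v : V) :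
    (∃ L ∈ outgoingPOFs G v₀ u, G.dist u v ≤ phi G v₀ u L) ∨
      ∃ X ∈ ingoingPOFs G v₀ u, G.dist u v ≤ psi G v₀ u X := by
  obtain ⟨m, hm, -⟩ := hG.existsUnique_median u v v₀
  by_cases hmu : m = u
  · subst hmu
    have hI : m ∈ interval G v₀ v := by
      have := hm.1.2
      simp only [interval, Set.mem_ofPred_eq] at this ⊢
      rw [G.dist_comm (u := v₀), G.dist_comm (u := m) (v := v), G.dist_comm (u := v₀) (v := v)]
      omega
    refine .inl ⟨_, hG.ladderSet_mem_outgoingPOFs hI, ?_⟩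
    have hd : G.dist m v ∈ phiDistances G v₀ m (ladderSet G m v) := ⟨v, hI, rfl, rfl⟩
    exact (isGreatest_sSup_of_dist_le ⟨_, hd⟩ exists_dist_of_mem_phiDistances).2 hd
  · obtain ⟨p, X, hX, hcube, hpen⟩ := hG.exists_isPenultimate hm.2 hmu
    have hd : G.dist u v ∈ psiDistances G v₀ u X := ⟨v, m, p, hm, hmu, hcube, hpen, rfl⟩
    exact .inr ⟨X, hX, (isGreatest_sSup_of_dist_le ⟨_, hd⟩ exists_dist_of_mem_psiDistances).2 hd⟩

theorem exists_isGreatest_image {α : Type*} [Finite α] (f : α → ℕ) {S : Set α} (hS : S.Nonempty) :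
    ∃ a, IsGreatest (f '' S) a := by
  obtain ⟨x, hx, h⟩ := Set.exists_max_image S f (Set.toFinite _) hS
  exact ⟨f x, ⟨x, hx, rfl⟩, by rintro _ ⟨y, hy, rfl⟩; exact h y hy⟩

theorem exists_dist_eq_eccent [Finite V] (hc : G.Connected) (u : V) :
    ∃ w, G.eccent u = G.dist u w ∧ ∀ v, G.dist u v ≤ G.dist u w := by
  have : Nonempty V := ⟨u⟩
  obtain ⟨w, hw⟩ := Finite.exists_max (G.dist u)
  refine ⟨w, le_antisymm ?_ ?_, hw⟩
  · rw [SimpleGraph.eccent_le_iff]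
    intro v
    rw [← (hc u v).coe_dist_eq_edist]
    exact_mod_cast hw v
  · rw [(hc u w).coe_dist_eq_edist]
    exact SimpleGraph.edist_le_eccent

end MedianGraph

theorem mainTheorem2 {V : Type*} [Finite V] (G : SimpleGraph V)
    (hG : MedianGraph.IsMedianGraph G) (v₀ u : V) :
    (∀ L ∈ MedianGraph.outgoingPOFs G v₀ u,
      IsGreatest (MedianGraph.phiDistances G v₀ u L) (MedianGraph.phi G v₀ u L)) ∧
    (∀ X ∈ MedianGraph.ingoingPOFs G v₀ u, X.Nonempty →
      IsGreatest (MedianGraph.psiDistances G v₀ u X) (MedianGraph.psi G v₀ u X)) ∧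
    ∃ a b : ℕ,
      IsGreatest (MedianGraph.phi G v₀ u '' MedianGraph.outgoingPOFs G v₀ u) a ∧
      IsGreatest (MedianGraph.psi G v₀ u '' MedianGraph.ingoingPOFs G v₀ u) b ∧
      G.eccent u = ((max a b : ℕ) : ℕ∞) := by
  refine ⟨fun L hL => MedianGraph.isGreatest_sSup_of_dist_le (hG.phiDistances_nonempty hL)
      MedianGraph.exists_dist_of_mem_phiDistances,
    fun X hX hne => MedianGraph.isGreatest_sSup_of_dist_le (hG.psiDistances_nonempty hX hne)
      MedianGraph.exists_dist_of_mem_psiDistances, ?_⟩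
  obtain ⟨a, ha⟩ := MedianGraph.exists_isGreatest_image (MedianGraph.phi G v₀ u)
    (S := MedianGraph.outgoingPOFs G v₀ u) ⟨∅, Set.pairwise_empty _, fun _ h => h.elim⟩
  -- The empty POF is always ingoing, so the maximum exists even at `u = v₀`, where its label `0`
  -- does no harm.
  obtain ⟨b, hb⟩ := MedianGraph.exists_isGreatest_image (MedianGraph.psi G v₀ u)
    (S := MedianGraph.ingoingPOFs G v₀ u) ⟨∅, Set.pairwise_empty _, fun _ h => h.elim⟩
  refine ⟨a, b, ha, hb, ?_⟩
  obtain ⟨w, hw, hmax⟩ := MedianGraph.exists_dist_eq_eccent hG.connected u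
  rw [hw, Nat.cast_inj]
  apply le_antisymm
  · rcases hG.dist_le_label v₀ u w with ⟨L, hL, h⟩ | ⟨X, hX, h⟩
    · exact le_max_of_le_left (h.trans (ha.2 ⟨L, hL, rfl⟩))
    · exact le_max_of_le_right (h.trans (hb.2 ⟨X, hX, rfl⟩))
  · obtain ⟨L, -, rfl⟩ := ha.1
    obtain ⟨X, -, rfl⟩ := hb.1
    exact max_le (MedianGraph.phi_le hmax L) (MedianGraph.psi_le hmax X)
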